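/- All graphs are finite and simple, and eigenvalues of a graph are those of its $(0,1)$-adjacency matrix. A graph $G=(V,E)$ is a *threshold graph* if there are $w:V\to[0,\infty)$ and $t\ge 0$ such that a set $X\subseteq V$ is independent if and only if $\sum_{v\in X}w(v)\le t$. A binary string $b_1b_2\cdots b_n$ with $b_1=0$ describes the graph on $v_1,\dots,v_n$ in which, for $i<j$, $v_i$ and $v_j$ are adjacent if and only if $b_j=1$; it is a threshold graph. The connected anti-regular graph $A_n$ (the unique connected graph on $n$ vertices whose degree sequence has $n-1$ distinct entries) has binary string $0101\cdots01$ for $n$ even and $00101\cdots01$ for $n$ odd. Let $\mu^+(G)$ be the smallest positive eigenvalue of $G$, and $\mu^-(G)$ the largest eigenvalue of $G$ less than $-1$, when such eigenvalues exist. **Theorem.** Let $n\ge 2$ be even. 1. For every threshold graph $G$ on $n$ vertices with at least one edge, $\mu^+(A_n)$ and $\mu^+(G)$ exist and $\mu^+(A_n)\le\mu^+(G)$. Now let $G$ be a graph on $n$ vertices with binary string $0^{s_1}1^{t_1}\cdots0^{s_k}1^{t_k}$, where $k\ge1$ and all $s_i,t_i\ge1$. 2. If $s_1=1$, then $\mu^-(G)\le\mu^-(A_n)$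 whenever $\mu^-(G)$ exists (in which case $\mu^-(A_n)$ exists too); $\mu^-(G)$ exists if $k\ge2$. 3. If $s_1\ge2$ and $2k+2<n$, then $\mu^-(G)$ and $\mu^-(A_n)$ exist and $\mu^-(G)\le\mu^-(A_n)$. -/

import Mathlib

namespace ThresholdGraph

/-- `G` is a threshold graph: there are nonnegative vertex weights and a threshold `t ≥ 0` such
that a set of vertices is independent if and only if its total weight is at most `t`. -/
def IsThreshold {V : Type*} (G : SimpleGraph V) : Prop :=
  ∃ (w : V → ℝ) (t : ℝ), (∀ v, 0 ≤ w v) ∧ 0 ≤ t ∧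
    ∀ X : Finset V, G.IsIndepSet (X : Set V) ↔ ∑ v ∈ X, w v ≤ t

/-- The graph built from a binary string `b` (`true` is the digit 1): the vertices are added in
order, and vertex `j` is joined to all earlier vertices if `b j = true` and to no earlier vertex if
`b j = false`.  The first digit plays no role. -/
def ofString {n : ℕ} (b : Fin n → Bool) : SimpleGraph (Fin n) where
  Adj i j := i ≠ j ∧ b (max i j) = true
  symm := ⟨fun i j h => ⟨h.1.symm, by rw [max_comm]; exact h.2⟩⟩
  loopless := ⟨fun _ h => h.1 rfl⟩

/-- The string `0^{s_1} 1^{t_1} ⋯ 0^{s_k} 1^{t_k}`. -/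
def blockString {k : ℕ} (s t : Fin k → ℕ) : List Bool :=
  (List.ofFn fun i => List.replicate (s i) false ++ List.replicate (t i) true).flatten

/-- `G` is (isomorphic to) the threshold graph with binary string
`0^{s_1} 1^{t_1} ⋯ 0^{s_k} 1^{t_k}`, where all exponents are positive. -/
def HasBlockString {V : Type*} (G : SimpleGraph V) {k : ℕ} (s t : Fin k → ℕ) : Prop :=
  (∀ i, 1 ≤ s i) ∧ (∀ i, 1 ≤ t i) ∧
    ∃ (n : ℕ) (b : Fin n → Bool), List.ofFn b = blockString s t ∧ Nonempty (G ≃g ofString b)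

/-- The binary string `0101⋯01` (for even `n`) or `00101⋯01` (for odd `n`), of length `n`. -/
def antiregularString (n : ℕ) : Fin n → Bool :=
  fun i => decide (0 < (i : ℕ) ∧ Odd (n - (i : ℕ)))

/-- The connected anti-regular graph `A_n`. -/
def antiregular (n : ℕ) : SimpleGraph (Fin n) := ofString (antiregularString n)

open Classical in
/-- `x` is an eigenvalue of the `(0,1)`-adjacency matrix of `G`. -/
def IsEigenvalue {V : Type*} [Fintype V] (G : SimpleGraph V) (x : ℝ) : Prop :=
  Module.End.HasEigenvalue (Matrix.toLin' (G.adjMatrix ℝ)) x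

/-- `x = μ⁺(G)`: `x` is the smallest positive eigenvalue of `G`. -/
def IsMuPlus {V : Type*} [Fintype V] (G : SimpleGraph V) (x : ℝ) : Prop :=
  IsLeast {y : ℝ | IsEigenvalue G y ∧ 0 < y} x

/-- `x = μ⁻(G)`: `x` is the largest eigenvalue of `G` less than `-1`. -/
def IsMuMinus {V : Type*} [Fintype V] (G : SimpleGraph V) (x : ℝ) : Prop :=
  IsGreatest {y : ℝ | IsEigenvalue G y ∧ y < -1} x

lemma antiregular_adj {n : ℕ} (i j : Fin n) :
    (antiregular n).Adj i j ↔ i ≠ j ∧ Odd (n - (max i j : Fin n).val) := by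
  simp only [antiregular, ofString, antiregularString, decide_eq_true_eq]
  constructor
  · rintro ⟨h, -, h2⟩
    exact ⟨h, h2⟩
  · rintro ⟨h, h2⟩
    refine ⟨h, ?_, h2⟩
    rcases lt_or_gt_of_ne h with h | h
    · rw [max_eq_right h.le]; have : i.val < j.val := h; omega
    · rw [max_eq_left h.le]; have : j.val < i.val := h; omega

/-- `A_n` is connected. -/
theorem antiregular_connected {n : ℕ} (hn : 1 ≤ n) : (antiregular n).Connected := by
  have : Nonempty (Fin n) := ⟨⟨0, hn⟩⟩
  have key : ∀ v : Fin n, (antiregular n).Reachable v ⟨n - 1, by omega⟩ := by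
    intro v
    by_cases h : v = ⟨n - 1, by omega⟩
    · rw [h]
    · refine SimpleGraph.Adj.reachable ((antiregular_adj _ _).2 ⟨h, ?_⟩)
      have hle : v ≤ (⟨n - 1, by omega⟩ : Fin n) := by
        rw [Fin.le_def]; have := v.2; simp only; omega
      rw [max_eq_right hle]
      have : n - (n - 1) = 1 := by omega
      simp [this]
  exact ⟨fun u v => (key u).trans (key v).symm⟩

lemma card_odd_above (n j : ℕ) :
    ((Finset.range n).filter fun i => j < i ∧ Odd (n - i)).card = (n - j) / 2 := by
  have : ((Finset.range n).filter fun i => j < i ∧ Odd (n - i))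
      = (Finset.range ((n - j) / 2)).image fun m => n - 1 - 2 * m := by
    ext i
    simp only [Finset.mem_filter, Finset.mem_range, Finset.mem_image]
    constructor
    · rintro ⟨h1, h2, m, hm⟩
      exact ⟨m, by omega, by omega⟩
    · rintro ⟨m, hm, rfl⟩
      exact ⟨by omega, by omega, m, by omega⟩
  rw [this, Finset.card_image_of_injOn, Finset.card_range]
  intro a ha b hb hab
  simp only [Finset.coe_range, Set.mem_Iio] at ha hb
  simp only at hab
  omega

open Classical in
lemma antiregular_degree {n : ℕ} (j : Fin n) :
    (antiregular n).degree j = (n - j) / 2 + if Odd (n - (j : ℕ)) then (j : ℕ) else 0 := by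
  have h1 : (antiregular n).degree j = ((Finset.range n).filter fun i =>
      (j.val < i ∧ Odd (n - i)) ∨ (i < j.val ∧ Odd (n - j.val))).card := by
    rw [← SimpleGraph.card_neighborFinset_eq_degree]
    refine Finset.card_bij (fun i _ => i.val) ?_ ?_ ?_
    · intro i hi
      rw [SimpleGraph.mem_neighborFinset, antiregular_adj] at hi
      obtain ⟨h, h2⟩ := hi
      simp only [Finset.mem_filter, Finset.mem_range]
      refine ⟨i.2, ?_⟩
      rcases lt_or_gt_of_ne h with h | h
      · rw [max_eq_right h.le] at h2; exact Or.inl ⟨h, h2⟩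
      · rw [max_eq_left h.le] at h2; exact Or.inr ⟨h, h2⟩
    · intro a _ b _ h; exact Fin.ext h
    · intro i hi
      simp only [Finset.mem_filter, Finset.mem_range] at hi
      refine ⟨⟨i, hi.1⟩, ?_, rfl⟩
      rw [SimpleGraph.mem_neighborFinset, antiregular_adj]
      rcases hi.2 with ⟨h, h2⟩ | ⟨h, h2⟩
      · have h' : j < (⟨i, hi.1⟩ : Fin n) := h
        rw [max_eq_right h'.le]; exact ⟨h'.ne, h2⟩
      · have h' : (⟨i, hi.1⟩ : Fin n) < j := h
        rw [max_eq_left h'.le]; exact ⟨h'.ne', h2⟩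
  rw [h1, Finset.filter_or, Finset.card_union_of_disjoint, card_odd_above]
  · congr 1
    split_ifs with h
    · have : ((Finset.range n).filter fun i => i < j.val ∧ Odd (n - j.val))
          = Finset.range j.val := by
        ext i
        simp only [Finset.mem_filter, Finset.mem_range, h, and_true]
        have := j.2
        omega
      rw [this, Finset.card_range]
    · simp [h]
  · rw [Finset.disjoint_left]
    intro i hi hi'
    simp only [Finset.mem_filter] at hi hi'
    omega

open Classical in
/-- Together with connectedness this characterizes `A_n`: its degree sequence has `n - 1` distinct entries
(namely `1, …, n - 1`). -/
theorem antiregular_degrees {n : ℕ} (hn : 2 ≤ n) :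
    (Finset.univ.image fun v => (antiregular n).degree v) = Finset.Icc 1 (n - 1) := by
  ext d
  simp only [Finset.mem_image, Finset.mem_univ, true_and, Finset.mem_Icc, antiregular_degree]
  constructor
  · rintro ⟨j, rfl⟩
    have := j.2
    split_ifs with h
    · obtain ⟨m, hm⟩ := h
      omega
    · rw [Nat.not_odd_iff_even] at h
      obtain ⟨m, hm⟩ := h
      omega
  · rintro ⟨h1, h2⟩
    by_cases h : 2 * d < n
    · refine ⟨⟨n - 2 * d, by omega⟩, ?_⟩
      have : ¬ Odd (n - (n - 2 * d)) := by
        rw [Nat.not_odd_iff_even]; exact ⟨d, by omega⟩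
      simp only [this, if_false]
      omega
    · refine ⟨⟨2 * d + 1 - n, by omega⟩, ?_⟩
      have : Odd (n - (2 * d + 1 - n)) := ⟨n - d - 1, by omega⟩
      simp only [this, if_true]
      omega

end ThresholdGraph

/-! Eigenvalues are counted, not computed. For `ε = ±1`, the number of eigenvalues `z` with `ε (z -
x) < 0` is the negative index of the form `ε (A - x)`, that is, the largest dimension of a subspace
on which this form is negative. Such an index passes from an induced subgraph to the whole graph,
and restricting to the kernel of `r` linear functionals lowers it by at most `r`.

A graph with `k` blocks contains `A_{2k}`, and contains `A_{2k+1}` if `s_1 ≥ 2`. Explicit subspaces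
show that `A_{2m}` has at least `m` positive eigenvalues and at least `m - 1` below `-1`, and that
`A_{2m+1}` has at least `m` below `-1`. Conversely, the sums over the blocks of ones are `k`
functionals showing that `G` has at most `k` positive eigenvalues and at most `k` below `-1`; one
functional fewer suffices for the latter if `s_1 = 1`.

Let `n = 2m` and suppose that the inequality for `μ⁺` fails. Some `y` lies strictly between `μ⁺(G)`
and `μ⁺(A_n)`, so `A_n` has `m` eigenvalues above `y`. Each step from `A_{j+2}` to `A_j` loses at
most one of them (`antiregular_hasNegSubspace_of_add_two`), so `A_{2k}`, and hence `G`, has `k`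
eigenvalues above `y`. Together with `μ⁺(G)`, this makes `k + 1` positive eigenvalues, a
contradiction. The argument for `μ⁻` with `s_1 = 1` is the same. For `s_1 ≥ 2` the descent must end
at `A_{2k+1}`; its last step goes from `A_{2k+4}` to `A_{2k+1}`, again at the cost of only one
eigenvalue (`antiregular_hasNegSubspace_of_add_three`). -/

open Module in
/-- `q` is negative on the nonzero vectors of some subspace of dimension at least `d`. -/
def HasNegSubspace {E : Type*} [AddCommGroup E] [Module ℝ E] (q : E → ℝ) (d : ℕ) : Prop :=
  ∃ W : Submodule ℝ E, d ≤ finrank ℝ W ∧ ∀ w ∈ W, w ≠ 0 → q w < 0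

/-! ### Negative index of a quadratic form -/

namespace HasNegSubspace

open Module

variable {E E' F : Type*} [AddCommGroup E] [Module ℝ E] [AddCommGroup E'] [Module ℝ E']
  [AddCommGroup F] [Module ℝ F] {q : E → ℝ} {q' : E' → ℝ} {d d' : ℕ}

lemma anti (h : HasNegSubspace q d) (hd : d' ≤ d) : HasNegSubspace q d' := by
  obtain ⟨W, hW, h⟩ := h
  exact ⟨W, hd.trans hW, h⟩

lemma of_top [FiniteDimensional ℝ E] (h : ∀ w : E, w ≠ 0 → q w < 0) :
    HasNegSubspace q (finrank ℝ E) :=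
  ⟨⊤, by simp, fun w _ => h w⟩

/-- The kernel of `φ` cuts the dimension of a negative subspace by at most `finrank ℝ F`. On what
remains `f` is injective, since `f u = 0` would give `0 = q' 0 ≤ q u < 0`. -/
lemma map_of_ker [FiniteDimensional ℝ E] [FiniteDimensional ℝ E'] [FiniteDimensional ℝ F]
    (f : E →ₗ[ℝ] E') (φ : E →ₗ[ℝ] F) (hq' : q' 0 = 0)
    (hf : ∀ u, φ u = 0 → q' (f u) ≤ q u) (h : HasNegSubspace q (d + finrank ℝ F)) :
    HasNegSubspace q' d := by
  obtain ⟨W, hW, h⟩ := h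
  have h1 := (φ.domRestrict W).finrank_range_add_finrank_ker
  have h2 : finrank ℝ (LinearMap.range (φ.domRestrict W)) ≤ finrank ℝ F := Submodule.finrank_le _
  set K := LinearMap.ker (φ.domRestrict W) with hK
  have hinj : Function.Injective ((f.domRestrict W).domRestrict K) := by
    rw [← LinearMap.ker_eq_bot, LinearMap.ker_eq_bot']
    intro u hu
    by_contra hne
    have hu0 : (u : W).1 ≠ 0 := fun h0 => hne (Subtype.ext (Subtype.ext h0))
    have hu1 : φ (u : W).1 = 0 := u.2
    have hu2 : f (u : W).1 = 0 := hu
    have := hf _ hu1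
    rw [hu2, hq'] at this
    exact absurd (h _ (u : W).2 hu0) (not_lt.2 this)
  refine ⟨LinearMap.range ((f.domRestrict W).domRestrict K), ?_, ?_⟩
  · rw [LinearMap.finrank_range_of_inj hinj]
    omega
  · rintro _ ⟨u, rfl⟩ hu
    have hu0 : (u : W).1 ≠ 0 := by
      intro h0
      apply hu
      have : u = 0 := Subtype.ext (Subtype.ext h0)
      rw [this, map_zero]
    exact (hf _ u.2).trans_lt (h _ (u : W).2 hu0)

lemma map [FiniteDimensional ℝ E] [FiniteDimensional ℝ E']
    (f : E →ₗ[ℝ] E') (hq' : q' 0 = 0) (hf : ∀ u, q' (f u) ≤ q u) (h : HasNegSubspace q d) :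
    HasNegSubspace q' d :=
  map_of_ker f (0 : E →ₗ[ℝ] (Fin 0 → ℝ)) hq' (fun u _ => hf u) (by simpa using h)

lemma le_of_ker [FiniteDimensional ℝ E] [FiniteDimensional ℝ F] (φ : E →ₗ[ℝ] F)
    (hφ : ∀ u, φ u = 0 → 0 ≤ q u) (h : HasNegSubspace q d) : d ≤ finrank ℝ F := by
  by_contra! hd
  obtain ⟨W, hW, -⟩ := map_of_ker (d := 1) (q' := fun _ : Fin 0 → ℝ => (0 : ℝ)) 0 φ rfl hφ
    (h.anti (by omega))
  have := Submodule.finrank_le W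
  rw [finrank_fin_fun] at this
  omega

/-- Sylvester's law of inertia: the form is nonnegative where the coordinates with negative
coefficient vanish, and negative on the nonzero vectors supported on those coordinates. -/
lemma iff_of_diagonal {ι : Type*} [Fintype ι] [FiniteDimensional ℝ E] (c : E ≃ₗ[ℝ] (ι → ℝ))
    (μ : ι → ℝ) [DecidablePred fun i => μ i < 0] (hq : ∀ u, q u = ∑ i, μ i * c u i ^ 2) :
    HasNegSubspace q d ↔ d ≤ (Finset.univ.filter fun i => μ i < 0).card := by
  have hcard : finrank ℝ ({i // μ i < 0} → ℝ) = (Finset.univ.filter fun i => μ i < 0).card := by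
    simp [Fintype.card_subtype]
  rw [← hcard]
  constructor
  · refine le_of_ker ((LinearMap.funLeft ℝ ℝ Subtype.val).comp c.toLinearMap) fun u hu => ?_
    rw [hq]
    refine Finset.sum_nonneg fun i _ => ?_
    by_cases hi : μ i < 0
    · have : c u i = 0 := congrFun hu ⟨i, hi⟩
      simp [this]
    · exact mul_nonneg (not_lt.1 hi) (sq_nonneg _)
  · intro hd
    refine anti ?_ hd
    let g : ({i // μ i < 0} → ℝ) →ₗ[ℝ] (ι → ℝ) :=
      LinearMap.pi fun i => if h : μ i < 0 then LinearMap.proj ⟨i, h⟩ else 0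
    have hg : ∀ t i, (g t i) = if h : μ i < 0 then t ⟨i, h⟩ else 0 := by
      intro t i
      simp only [g, LinearMap.pi_apply]
      split_ifs <;> rfl
    refine map (q := fun t => q (c.symm (g t))) (c.symm.toLinearMap.comp g) (by simp [hq])
      (fun u => le_rfl) (of_top fun t ht => ?_)
    obtain ⟨i, hi⟩ := Function.ne_iff.1 ht
    simp only [hq, LinearEquiv.apply_symm_apply]
    refine Finset.sum_neg' (fun j _ => ?_) ⟨i.1, Finset.mem_univ _, ?_⟩
    · rw [hg]
      split_ifs with h
      · exact mul_nonpos_of_nonpos_of_nonneg h.le (sq_nonneg _)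
      · simp
    · rw [hg, dif_pos i.2]
      exact mul_neg_of_neg_of_pos i.2 (pow_two_pos_of_ne_zero hi)

end HasNegSubspace

/-! ### Eigenvalue counts as negative indices -/

namespace ThresholdGraph

open Matrix

variable {V W : Type*} [Fintype V] [Fintype W]

open Classical in
/-- The quadratic form of the adjacency matrix. -/
noncomputable def quadForm (G : SimpleGraph V) (u : V → ℝ) : ℝ :=
  ∑ v, ∑ w, if G.Adj v w then u v * u w else 0

/-- The quadratic form of `ε • (A - x)`, where `A` is the adjacency matrix. -/
noncomputable def shiftedForm (G : SimpleGraph V) (ε x : ℝ) (u : V → ℝ) : ℝ :=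
  ε * (quadForm G u - x * ∑ v, u v ^ 2)

@[simp] lemma quadForm_zero (G : SimpleGraph V) : quadForm G 0 = 0 := by simp [quadForm]

@[simp] lemma shiftedForm_zero (G : SimpleGraph V) (ε x : ℝ) : shiftedForm G ε x 0 = 0 := by
  simp [shiftedForm]

open Classical in
lemma quadForm_eq_dotProduct (G : SimpleGraph V) (u : V → ℝ) :
    quadForm G u = u ⬝ᵥ G.adjMatrix ℝ *ᵥ u := by
  simp only [quadForm, dotProduct, mulVec, Finset.mul_sum, SimpleGraph.adjMatrix_apply]
  refine Finset.sum_congr rfl fun v _ => Finset.sum_congr rfl fun w _ => ?_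
  split_ifs <;> simp

open Classical in
lemma isHermitian_adjMatrix {V : Type*} (G : SimpleGraph V) : (G.adjMatrix ℝ).IsHermitian := by
  rw [Matrix.IsHermitian, conjTranspose_eq_transpose_of_trivial, SimpleGraph.transpose_adjMatrix]

open Classical in
/-- The eigenvalues of `G`, with multiplicity. -/
noncomputable def eigenvalue (G : SimpleGraph V) : V → ℝ := (isHermitian_adjMatrix G).eigenvalues

lemma isEigenvalue_iff {G : SimpleGraph V} {x : ℝ} : IsEigenvalue G x ↔ ∃ v, eigenvalue G v = x := by
  classical
  rw [IsEigenvalue, Module.End.hasEigenvalue_iff_mem_spectrum, spectrum_toLin',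
    (isHermitian_adjMatrix G).spectrum_real_eq_range_eigenvalues]
  rfl

lemma exists_diagonalization (G : SimpleGraph V) : ∃ c : (V → ℝ) ≃ₗ[ℝ] (V → ℝ), ∀ u,
    quadForm G u = ∑ v, eigenvalue G v * c u v ^ 2 ∧ ∑ v, u v ^ 2 = ∑ v, c u v ^ 2 := by
  classical
  set hA := isHermitian_adjMatrix G with hA'
  set U : Matrix V V ℝ := (hA.eigenvectorUnitary : Matrix V V ℝ) with hU
  have h1 : U * Uᵀ = 1 := by
    have := Unitary.coe_mul_star_self hA.eigenvectorUnitary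
    rwa [Unitary.coe_star, star_eq_conjTranspose, conjTranspose_eq_transpose_of_trivial] at this
  have h2 : Uᵀ * U = 1 := by
    have := Unitary.coe_star_mul_self hA.eigenvectorUnitary
    rwa [star_eq_conjTranspose, conjTranspose_eq_transpose_of_trivial] at this
  have h3 : G.adjMatrix ℝ = U * diagonal (eigenvalue G) * Uᵀ := by
    have := hA.spectral_theorem
    rwa [Unitary.conjStarAlgAut_apply, star_eq_conjTranspose,
      conjTranspose_eq_transpose_of_trivial] at this
  refine ⟨toLin'OfInv h1 h2, fun u => ?_⟩
  have hc : ∀ v, toLin'OfInv h1 h2 u v = (Uᵀ *ᵥ u) v := fun v => rfl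
  simp only [hc]
  constructor
  · rw [quadForm_eq_dotProduct, h3, ← mulVec_mulVec, ← mulVec_mulVec, dotProduct_mulVec,
      ← mulVec_transpose]
    simp only [dotProduct, mulVec_diagonal]
    exact Finset.sum_congr rfl fun v _ => by ring
  · have : u ⬝ᵥ u = (Uᵀ *ᵥ u) ⬝ᵥ (Uᵀ *ᵥ u) := by
      rw [dotProduct_mulVec, ← mulVec_transpose, transpose_transpose, mulVec_mulVec, h1, one_mulVec]
    simpa only [dotProduct, ← sq] using this

open Classical in
lemma hasNegSubspace_shiftedForm_iff {G : SimpleGraph V} {ε x : ℝ} {d : ℕ} :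
    HasNegSubspace (shiftedForm G ε x) d ↔
      d ≤ (Finset.univ.filter fun v => ε * (eigenvalue G v - x) < 0).card := by
  obtain ⟨c, hc⟩ := exists_diagonalization G
  refine HasNegSubspace.iff_of_diagonal c _ fun u => ?_
  rw [shiftedForm, (hc u).1, (hc u).2, Finset.mul_sum, ← Finset.sum_sub_distrib, Finset.mul_sum]
  exact Finset.sum_congr rfl fun v _ => by ring

/-- If no eigenvalue lies between `x` and `y`, the number of eigenvalues beyond `x` is at most the
number of eigenvalues beyond `y`. -/
lemma hasNegSubspace_of_forall {G : SimpleGraph V} {ε x y : ℝ} {d : ℕ}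
    (h : ∀ z, IsEigenvalue G z → ε * (z - x) < 0 → ε * (z - y) < 0)
    (hd : HasNegSubspace (shiftedForm G ε x) d) : HasNegSubspace (shiftedForm G ε y) d := by
  classical
  rw [hasNegSubspace_shiftedForm_iff] at hd ⊢
  refine hd.trans (Finset.card_le_card fun v hv => ?_)
  simp only [Finset.mem_filter, Finset.mem_univ, true_and] at hv ⊢
  exact h _ (isEigenvalue_iff.2 ⟨v, rfl⟩) hv

lemma exists_isEigenvalue {G : SimpleGraph V} {ε x : ℝ}
    (h : HasNegSubspace (shiftedForm G ε x) 1) : ∃ z, IsEigenvalue G z ∧ ε * (z - x) < 0 := by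
  classical
  rw [hasNegSubspace_shiftedForm_iff, Nat.one_le_iff_ne_zero, Finset.card_ne_zero] at h
  obtain ⟨v, hv⟩ := h
  exact ⟨_, isEigenvalue_iff.2 ⟨v, rfl⟩, (Finset.mem_filter.1 hv).2⟩

lemma hasNegSubspace_one {G : SimpleGraph V} {ε x z : ℝ} (hz : IsEigenvalue G z)
    (h : ε * (z - x) < 0) : HasNegSubspace (shiftedForm G ε x) 1 := by
  classical
  obtain ⟨v, rfl⟩ := isEigenvalue_iff.1 hz
  rw [hasNegSubspace_shiftedForm_iff, Nat.one_le_iff_ne_zero, Finset.card_ne_zero]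
  exact ⟨v, Finset.mem_filter.2 ⟨Finset.mem_univ _, h⟩⟩

/-- An eigenvalue between `x` and `y` adds to the number of eigenvalues beyond `y`. -/
lemma hasNegSubspace_succ {G : SimpleGraph V} {ε x y z : ℝ} {d : ℕ} (hz : IsEigenvalue G z)
    (hx : ε * (z - x) < 0) (hy : 0 ≤ ε * (z - y)) (hd : HasNegSubspace (shiftedForm G ε y) d) :
    HasNegSubspace (shiftedForm G ε x) (d + 1) := by
  classical
  rw [hasNegSubspace_shiftedForm_iff] at hd ⊢
  obtain ⟨v, rfl⟩ := isEigenvalue_iff.1 hz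
  refine Nat.succ_le_of_lt (hd.trans_lt (Finset.card_lt_card ?_))
  refine ⟨fun w hw => ?_, fun h => ?_⟩
  · simp only [Finset.mem_filter, Finset.mem_univ, true_and] at hw ⊢
    nlinarith
  · have := h (Finset.mem_filter.2 ⟨Finset.mem_univ v, hx⟩)
    exact absurd (Finset.mem_filter.1 this).2 (not_lt.2 hy)

lemma finite_setOf_isEigenvalue (G : SimpleGraph V) : {z | IsEigenvalue G z}.Finite := by
  refine (Set.finite_range (eigenvalue G)).subset fun z hz => isEigenvalue_iff.1 hz

lemma exists_isMuPlus {G : SimpleGraph V} (h : HasNegSubspace (shiftedForm G (-1) 0) 1) :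
    ∃ a, IsMuPlus G a := by
  obtain ⟨z, hz, hz'⟩ := exists_isEigenvalue h
  obtain ⟨a, ha, h⟩ := Set.exists_min_image {y | IsEigenvalue G y ∧ 0 < y} id
    ((finite_setOf_isEigenvalue G).subset fun y hy => hy.1) ⟨z, hz, by linarith⟩
  exact ⟨a, ha, fun b hb => h b hb⟩

lemma exists_isMuMinus {G : SimpleGraph V} (h : HasNegSubspace (shiftedForm G 1 (-1)) 1) :
    ∃ a, IsMuMinus G a := by
  obtain ⟨z, hz, hz'⟩ := exists_isEigenvalue h
  obtain ⟨a, ha, h⟩ := Set.exists_max_image {y | IsEigenvalue G y ∧ y < -1} id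
    ((finite_setOf_isEigenvalue G).subset fun y hy => hy.1) ⟨z, hz, by linarith⟩
  exact ⟨a, ha, fun b hb => h b hb⟩

/-- Passing to an induced subgraph does not increase the number of eigenvalues beyond `x`. -/
lemma hasNegSubspace_of_embedding {G : SimpleGraph V} {H : SimpleGraph W} (f : G ↪g H) {ε x : ℝ}
    {d : ℕ} (h : HasNegSubspace (shiftedForm G ε x) d) :
    HasNegSubspace (shiftedForm H ε x) d := by
  classical
  refine h.map (Function.ExtendByZero.linearMap ℝ f) (by simp) fun u => le_of_eq ?_
  have hsum : ∀ g : W → ℝ, (∀ w, w ∉ Set.range f → g w = 0) → ∑ w, g w = ∑ v, g (f v) := by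
    intro g hg
    exact (Finset.sum_of_injOn f f.injective.injOn (fun _ _ => Finset.mem_coe.2 (Finset.mem_univ _))
      (fun w _ hw => hg w (by simpa using hw)) fun _ _ => rfl).symm
  have h0 : ∀ w, w ∉ Set.range f → Function.ExtendByZero.linearMap ℝ f u w = 0 := by
    intro w hw
    simpa using Function.extend_apply' u (0 : W → ℝ) w (by simpa using hw)
  have h1 : ∀ v, Function.ExtendByZero.linearMap ℝ f u (f v) = u v := by
    intro v
    simpa using f.injective.extend_apply u (0 : W → ℝ) v
  simp only [shiftedForm, quadForm]
  rw [hsum (fun w => ∑ w', _), hsum (fun w => _ ^ 2)]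
  · simp only [h1]
    congr 2
    refine Finset.sum_congr rfl fun v _ => ?_
    rw [hsum]
    · simp [h1]
    · intro w hw
      simp [h0 w hw]
  · intro w hw
    simp [h0 w hw]
  · intro w hw
    simp [h0 w hw]

end ThresholdGraph

namespace ThresholdGraph

open Finset

/-! ### The adjacency form of the anti-regular graph -/

/-- Each edge is charged to its later endpoint, so that only prefix sums of `U` enter. -/
lemma sum_max_pairs (b : ℕ → Prop) [DecidablePred b] (U : ℕ → ℝ) (n : ℕ) :
    (∑ i ∈ range n, ∑ j ∈ range n, if i ≠ j ∧ b (max i j) then U i * U j else 0) =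
      ∑ j ∈ range n, if b j then 2 * U j * ∑ i ∈ range j, U i else 0 := by
  induction n with
  | zero => simp
  | succ n ih =>
    have h1 : ∀ i ∈ range n, (if i ≠ n ∧ b (max i n) then U i * U n else 0) =
        if b n then U i * U n else 0 := by
      intro i hi
      have := mem_range.1 hi
      simp [this.ne, max_eq_right this.le]
    have h2 : ∀ i ∈ range n, (if n ≠ i ∧ b (max n i) then U n * U i else 0) =
        if b n then U i * U n else 0 := by
      intro i hi
      have := mem_range.1 hi
      simp [this.ne', max_eq_left this.le, mul_comm]
    rw [sum_range_succ, sum_range_succ, sum_range_succ, ← ih, sum_congr rfl h2]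
    simp only [sum_range_succ, sum_add_distrib]
    rw [sum_congr rfl h1]
    rw [if_neg fun h => h.1 rfl]
    split_ifs
    · rw [← sum_mul]
      ring
    · simp

open Classical in
lemma quadForm_antiregular (n : ℕ) (U : ℕ → ℝ) :
    quadForm (antiregular n) (fun i => U i) =
      ∑ j ∈ range n, if Odd (n - j) then 2 * U j * ∑ i ∈ range j, U i else 0 := by
  have := sum_max_pairs (fun j => Odd (n - j)) U n
  refine Eq.trans ?_ (this.trans ?_)
  · rw [quadForm, sum_range]
    refine sum_congr rfl fun i _ => ?_
    rw [sum_range]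
    refine sum_congr rfl fun j _ => if_congr ?_ rfl rfl
    rw [antiregular_adj, Ne, Fin.ext_iff, Fin.coe_max]
  · congr!

lemma exists_nat_extension {n : ℕ} (u : Fin n → ℝ) : ∃ U : ℕ → ℝ, u = fun i : Fin n => U i :=
  ⟨fun i => if h : i < n then u ⟨i, h⟩ else 0, by ext i; simp⟩

/-- The one condition imposed is that the last, dominating vertex has coordinate zero. The vertex
before it is then isolated and contributes `-ε x (U n)² ≥ 0`, so dropping it does not increase the
form. -/
lemma antiregular_hasNegSubspace_of_add_two {n d : ℕ} {ε x : ℝ} (hx : ε * x ≤ 0)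
    (h : HasNegSubspace (shiftedForm (antiregular (n + 2)) ε x) (d + 1)) :
    HasNegSubspace (shiftedForm (antiregular n) ε x) d := by
  refine HasNegSubspace.map_of_ker
    (LinearMap.funLeft ℝ ℝ (Fin.castLE (Nat.le_add_right n 2)))
    (LinearMap.proj (Fin.last (n + 1)) : (Fin (n + 2) → ℝ) →ₗ[ℝ] ℝ) (by simp) (fun u hu => ?_)
    (by simpa using h)
  obtain ⟨U, rfl⟩ := exists_nat_extension u
  have hU : U (n + 1) = 0 := by simpa using hu
  have h1 : (LinearMap.funLeft ℝ ℝ (Fin.castLE (Nat.le_add_right n 2)))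
      (fun i : Fin (n + 2) => U i) = fun i : Fin n => U i := rfl
  have h2 : ∀ j ∈ range n, (if Odd (n + 2 - j) then 2 * U j * ∑ i ∈ range j, U i else 0) =
      if Odd (n - j) then 2 * U j * ∑ i ∈ range j, U i else 0 := by
    intro j hj
    have := mem_range.1 hj
    refine if_congr ?_ rfl rfl
    rw [show n + 2 - j = n - j + 2 by omega, Nat.odd_add, iff_true_right even_two]
  rw [h1, shiftedForm, shiftedForm, quadForm_antiregular, quadForm_antiregular, sum_range_succ,
    sum_range_succ, sum_congr rfl h2, Fin.sum_univ_castSucc, Fin.sum_univ_castSucc]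
  simp only [Fin.val_castSucc, Fin.val_last, hU, add_tsub_cancel_left, Nat.not_odd_iff_even.2 even_two,
    if_false, mul_zero, zero_mul, ite_self, add_zero, ne_eq, OfNat.ofNat_ne_zero, not_false_eq_true,
    zero_pow]
  nlinarith [mul_nonneg (neg_nonneg.2 hx) (sq_nonneg (U n))]

/-- The first four vertices are merged into one carrying the sum of their coordinates. Later prefix
sums are unchanged, so the two forms differ only by a quadratic form in `U 0, …, U 3`. That form has
the right sign on a hyperplane, which costs a single dimension. -/
lemma antiregular_hasNegSubspace_of_add_three {k d : ℕ} {x : ℝ} (hx : x < -1)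
    (h : HasNegSubspace (shiftedForm (antiregular (2 * k + 4)) 1 x) (d + 1)) :
    HasNegSubspace (shiftedForm (antiregular (2 * k + 1)) 1 x) d := by
  obtain ⟨e, rfl⟩ : ∃ e, x = -1 - e := ⟨-1 - x, by ring⟩
  have he : 0 < e := by linarith
  let p : ℕ → (Fin (2 * k + 4) → ℝ) →ₗ[ℝ] ℝ := fun j =>
    if h : j < 2 * k + 4 then LinearMap.proj ⟨j, h⟩ else 0
  have hp : ∀ (U : ℕ → ℝ) (j : ℕ), j < 2 * k + 4 →
      p j (fun i : Fin (2 * k + 4) => U i) = U j := by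
    intro U j hj
    simp [p, hj]
  refine HasNegSubspace.map_of_ker
    (LinearMap.pi fun j : Fin (2 * k + 1) => if (j : ℕ) = 0 then p 0 + p 1 + p 2 + p 3
      else p (j + 3)) ((e / 2) • (p 0 + p 1) + (e + 1) • p 2 + e • p 3) (by simp) (fun u hu => ?_)
    (by simpa using h)
  obtain ⟨U, rfl⟩ := exists_nat_extension u
  have hu : e / 2 * (U 0 + U 1) + (e + 1) * U 2 + e * U 3 = 0 := by
    simpa [hp, mul_add] using hu
  let U' : ℕ → ℝ := fun j => if j = 0 then U 0 + U 1 + U 2 + U 3 else U (j + 3)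
  have hf : (LinearMap.pi fun j : Fin (2 * k + 1) => if (j : ℕ) = 0 then p 0 + p 1 + p 2 + p 3
      else p (j + 3)) (fun i : Fin (2 * k + 4) => U i) = fun j : Fin (2 * k + 1) => U' j := by
    ext j
    rw [LinearMap.pi_apply]
    simp only [U']
    split_ifs with hj
    · simp [hp]
    · exact hp _ _ (by omega)
  have h1 : ∀ j, ∑ i ∈ range (j + 1), U' i = ∑ i ∈ range (j + 4), U i := by
    intro j
    simp only [sum_range_succ' _ j, sum_range_succ' _ (j + 1), sum_range_succ' _ (j + 2),
      sum_range_succ' _ (j + 3), U', if_pos, Nat.succ_ne_zero, if_false, add_assoc]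
    norm_num
    ring
  rw [hf, shiftedForm, shiftedForm, quadForm_antiregular, quadForm_antiregular]
  have h2 : (∑ j ∈ range (2 * k + 4), if Odd (2 * k + 4 - j) then 2 * U j * ∑ i ∈ range j, U i
      else 0) = (∑ j ∈ range (2 * k + 1), if Odd (2 * k + 1 - j) then 2 * U' j *
      ∑ i ∈ range j, U' i else 0) + (2 * U 1 * U 0 + 2 * U 3 * (U 0 + U 1 + U 2)) := by
    have o1 : Odd (2 * k + 4 - 1) := ⟨k + 1, by omega⟩
    have o3 : Odd (2 * k + 4 - 3) := ⟨k, by omega⟩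
    have o2 : ¬ Odd (2 * k + 4 - 2) := Nat.not_odd_iff_even.2 ⟨k + 1, by omega⟩
    rw [sum_range_succ', sum_range_succ', sum_range_succ', sum_range_succ', sum_range_succ' _ (2 * k)]
    have h3 : ∀ j ∈ range (2 * k), (if Odd (2 * k + 1 - (j + 1)) then 2 * U' (j + 1) *
        ∑ i ∈ range (j + 1), U' i else 0) = if Odd (2 * k + 4 - (j + 1 + 1 + 1 + 1)) then
        2 * U (j + 1 + 1 + 1 + 1) * ∑ i ∈ range (j + 1 + 1 + 1 + 1), U i else 0 := by
      intro j _
      rw [h1, show 2 * k + 4 - (j + 1 + 1 + 1 + 1) = 2 * k + 1 - (j + 1) by omega]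
      rfl
    rw [sum_congr rfl h3]
    simp only [zero_add, Nat.reduceAdd, o1, o2, o3, if_true, if_false, sum_range_zero, mul_zero,
      ite_self, sum_range_succ]
    ring
  have h3 : ∑ i : Fin (2 * k + 4), U i ^ 2 = ∑ i : Fin (2 * k + 1), U' i ^ 2 + (U 0 ^ 2 + U 1 ^ 2 +
      U 2 ^ 2 + U 3 ^ 2 - (U 0 + U 1 + U 2 + U 3) ^ 2) := by
    rw [← sum_range fun i => U i ^ 2, ← sum_range fun i => U' i ^ 2, sum_range_succ',
      sum_range_succ', sum_range_succ', sum_range_succ', sum_range_succ' _ (2 * k)]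
    have h4 : ∀ j, U' (j + 1) = U (j + 1 + 1 + 1 + 1) := fun j => rfl
    have h5 : U' 0 = U 0 + U 1 + U 2 + U 3 := rfl
    simp only [h4, h5, zero_add, Nat.reduceAdd]
    ring
  -- The left side is half of the merged form minus the original one. For fixed `s = U 0 + U 1` it
  -- is largest at `U 0 = U 1 = s / 2`. The condition `hu` says that the derivative in `s` of the
  -- resulting quadratic vanishes; completing the square in `s` then leaves a nonpositive form in `U
  -- 2`, `U 3`.
  have key : e * (U 0 * U 1 + (U 0 + U 1) * U 2 + (U 0 + U 1) * U 3 + U 2 * U 3) +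
      (U 0 + U 1) * U 2 ≤ 0 := by
    obtain ⟨s, hs⟩ : ∃ s, s = U 0 + U 1 := ⟨_, rfl⟩
    have h6 : e * (U 0 * U 1) ≤ e * (s ^ 2 / 4) :=
      mul_le_mul_of_nonneg_left (by rw [hs]; nlinarith [sq_nonneg (U 0 - U 1)]) he.le
    have h7 : e * s = -2 * ((e + 1) * U 2 + e * U 3) := by rw [hs]; linarith
    have h8 : e * (e * (s ^ 2 / 4) + (e + 1) * s * U 2 + e * s * U 3 + e * U 2 * U 3) =
        -((e + 1) * U 2 + e * U 3) ^ 2 + e ^ 2 * U 2 * U 3 := by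
      linear_combination (e * s / 4 + ((e + 1) * U 2 + e * U 3) / 2) * h7
    have h9 : -((e + 1) * U 2 + e * U 3) ^ 2 + e ^ 2 * U 2 * U 3 ≤ 0 := by
      nlinarith [sq_nonneg (e * U 3 + (e + 2) / 2 * U 2), sq_nonneg (U 2), sq_nonneg (e * U 2), mul_nonneg he.le (sq_nonneg (U 2))]
    rw [← h8] at h9
    have := nonpos_of_mul_nonpos_right h9 he
    rw [← hs]
    linarith
  rw [h2, h3]
  nlinarith

/-- Coordinates on a subspace on which the adjacency form of `A_{2m}` is positive definite. -/
noncomputable def posCoords (S : ℕ → ℝ) (j : ℕ) : ℝ :=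
  if j % 2 = 1 then S (j / 2) else if j = 0 then S 0 else S (j / 2) - 2 * S (j / 2 - 1)

/-- The coordinates are chosen so that the prefix sum before the `i`-th one-vertex equals that
vertex's own coordinate `S i`; each one-vertex thus contributes `2 (S i)²`, with no cross terms. -/
lemma posCoords_sums (S : ℕ → ℝ) (m : ℕ) :
    ∑ j ∈ range (2 * (m + 1)), posCoords S j = 2 * S m ∧
      (∑ j ∈ range (2 * (m + 1)), if Odd j then 2 * posCoords S j * ∑ i ∈ range j, posCoords S i
        else 0) = 2 * ∑ i ∈ range (m + 1), S i ^ 2 := by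
  induction m with
  | zero =>
    simp [sum_range_succ, posCoords]
    ring_nf
    simp
  | succ m ih =>
    have h1 : posCoords S (2 * (m + 1)) = S (m + 1) - 2 * S m := by
      rw [posCoords, if_neg (by omega), if_neg (by omega), show 2 * (m + 1) / 2 = m + 1 by omega]
      rfl
    have h2 : posCoords S (2 * (m + 1) + 1) = S (m + 1) := by
      rw [posCoords, if_pos (by omega), show (2 * (m + 1) + 1) / 2 = m + 1 by omega]
    rw [show 2 * (m + 1 + 1) = 2 * (m + 1) + 1 + 1 by ring]
    simp only [sum_range_succ _ (2 * (m + 1) + 1), sum_range_succ _ (2 * (m + 1)),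
      sum_range_succ _ (m + 1), ih.1, ih.2, h1, h2]
    rw [if_neg (by rw [Nat.not_odd_iff_even]; exact even_two_mul _), if_pos ⟨m + 1, rfl⟩]
    constructor <;> ring

/-- Coordinates on a subspace on which the form of `A + 1` is negative definite, where `A` is the
adjacency matrix of `A_{2m+1}`. -/
noncomputable def negCoords (S : ℕ → ℝ) (j : ℕ) : ℝ :=
  if j = 0 then S 0 / 2 else if j % 2 = 1 then S (j / 2) / 2 else S (j / 2) / 2 - S (j / 2 - 1)

/-- The prefix sum before the one-vertex at `2 i + 2` is `S i`, and its coordinate is `S (i + 1) / 2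
- S i`. Edge terms and square together give `(S (i + 1) / 2)² - (S i)²`, and the sum telescopes. The
form is negative definite once the final parameter `S m` is set to zero. -/
lemma negCoords_sums (S : ℕ → ℝ) (m : ℕ) :
    ∑ j ∈ range (2 * m + 1), negCoords S j = S m / 2 ∧
      (∑ j ∈ range (2 * m + 1), if Even j then 2 * negCoords S j * ∑ i ∈ range j, negCoords S i
        else 0) + ∑ j ∈ range (2 * m + 1), negCoords S j ^ 2 =
        S m ^ 2 / 4 - (∑ i ∈ range m, S i ^ 2) / 2 := by
  induction m with
  | zero =>
    simp [negCoords]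
    ring
  | succ m ih =>
    have h1 : negCoords S (2 * m + 1) = S m / 2 := by
      rw [negCoords, if_neg (by omega), if_pos (by omega), show (2 * m + 1) / 2 = m by omega]
    have h2 : negCoords S (2 * m + 1 + 1) = S (m + 1) / 2 - S m := by
      rw [negCoords, if_neg (by omega), if_neg (by omega),
        show (2 * m + 1 + 1) / 2 = m + 1 by omega]
      rfl
    rw [show 2 * (m + 1) + 1 = 2 * m + 1 + 1 + 1 by ring]
    simp only [sum_range_succ _ (2 * m + 1 + 1), sum_range_succ _ (2 * m + 1),
      sum_range_succ _ m, ih.1, h1, h2]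
    rw [if_neg (by rw [Nat.not_even_iff_odd]; exact ⟨m, rfl⟩), if_pos ⟨m + 1, by ring⟩]
    exact ⟨by ring, by linear_combination ih.2⟩

lemma antiregular_hasNegSubspace_pos (m : ℕ) :
    HasNegSubspace (shiftedForm (antiregular (2 * m)) (-1) 0) m := by
  let g : (Fin m → ℝ) →ₗ[ℝ] (Fin (2 * m) → ℝ) :=
    { toFun := fun t j => posCoords (Function.ExtendByZero.linearMap ℝ Fin.val t) j
      map_add' := fun t t' => by
        ext j
        simp only [posCoords, map_add, Pi.add_apply]
        split_ifs <;> ring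
      map_smul' := fun c t => by
        ext j
        simp only [posCoords, map_smul, Pi.smul_apply, smul_eq_mul, RingHom.id_apply]
        split_ifs <;> ring }
  refine HasNegSubspace.map (q := fun t : Fin m → ℝ => -(2 * ∑ i, t i ^ 2)) g (by simp)
    (fun t => le_of_eq ?_) ?_
  · obtain _ | m := m
    · simp [shiftedForm, quadForm]
    · set S := Function.ExtendByZero.linearMap ℝ Fin.val t with hS
      have h1 : ∀ i : Fin (m + 1), t i = S i := fun i =>
        (Fin.val_injective.extend_apply t (0 : ℕ → ℝ) i).symm
      have h2 : g t = fun j : Fin (2 * (m + 1)) => posCoords S j := rfl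
      have h3 : ∀ j ∈ range (2 * (m + 1)), (if Odd (2 * (m + 1) - j) then 2 * posCoords S j *
          ∑ i ∈ range j, posCoords S i else 0) = if Odd j then 2 * posCoords S j *
          ∑ i ∈ range j, posCoords S i else 0 := by
        intro j hj
        refine if_congr ?_ rfl rfl
        rw [Nat.odd_sub' (mem_range.1 hj).le]
        simp
      rw [shiftedForm, h2, quadForm_antiregular, sum_congr rfl h3, (posCoords_sums S m).2,
        sum_range]
      simp only [h1]
      ring
  · refine (HasNegSubspace.of_top fun t ht => ?_).anti (by simp : m ≤ Module.finrank ℝ (Fin m → ℝ))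
    obtain ⟨i, hi⟩ := Function.ne_iff.1 ht
    have : 0 < ∑ i, t i ^ 2 := sum_pos' (fun i _ => sq_nonneg _)
      ⟨i, mem_univ _, pow_two_pos_of_ne_zero hi⟩
    simpa using this

lemma antiregular_hasNegSubspace_neg (m : ℕ) :
    HasNegSubspace (shiftedForm (antiregular (2 * m + 1)) 1 (-1)) m := by
  let g : (Fin m → ℝ) →ₗ[ℝ] (Fin (2 * m + 1) → ℝ) :=
    { toFun := fun t j => negCoords (Function.ExtendByZero.linearMap ℝ Fin.val t) j
      map_add' := fun t t' => by
        ext j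
        simp only [negCoords, map_add, Pi.add_apply]
        split_ifs <;> ring
      map_smul' := fun c t => by
        ext j
        simp only [negCoords, map_smul, Pi.smul_apply, smul_eq_mul, RingHom.id_apply]
        split_ifs <;> ring }
  refine HasNegSubspace.map (q := fun t : Fin m → ℝ => -((∑ i, t i ^ 2) / 2)) g (by simp)
    (fun t => le_of_eq ?_) ?_
  · set S := Function.ExtendByZero.linearMap ℝ Fin.val t with hS
    have h1 : ∀ i : Fin m, t i = S i := fun i =>
      (Fin.val_injective.extend_apply t (0 : ℕ → ℝ) i).symm
    -- The extension by zero removes the only positive term, `S m ^ 2 / 4`.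
    have h0 : S m = 0 := Function.extend_apply' t (0 : ℕ → ℝ) m
      fun ⟨i, hi⟩ => i.2.ne hi
    have h2 : g t = fun j : Fin (2 * m + 1) => negCoords S j := rfl
    have h3 : ∀ j ∈ range (2 * m + 1), (if Odd (2 * m + 1 - j) then 2 * negCoords S j *
        ∑ i ∈ range j, negCoords S i else 0) = if Even j then 2 * negCoords S j *
        ∑ i ∈ range j, negCoords S i else 0 := by
      intro j hj
      refine if_congr ?_ rfl rfl
      rw [Nat.odd_sub (mem_range.1 hj).le]
      simp
    have h4 := (negCoords_sums S m).2
    have h5 : ∑ i ∈ range m, S i ^ 2 = ∑ i, t i ^ 2 := by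
      simp only [h1, sum_range]
    rw [shiftedForm, h2, quadForm_antiregular, sum_congr rfl h3,
      ← sum_range fun i => negCoords S i ^ 2]
    rw [h0, h5] at h4
    linear_combination h4
  · refine (HasNegSubspace.of_top fun t ht => ?_).anti (by simp : m ≤ Module.finrank ℝ (Fin m → ℝ))
    obtain ⟨i, hi⟩ := Function.ne_iff.1 ht
    have : 0 < ∑ i, t i ^ 2 := sum_pos' (fun i _ => sq_nonneg _)
      ⟨i, mem_univ _, pow_two_pos_of_ne_zero hi⟩
    linarith

/-- Deleting the second vertex turns `0101⋯01` into `00101⋯01`. -/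
lemma nonempty_antiregular_embedding (m : ℕ) :
    Nonempty (antiregular (2 * m + 1) ↪g antiregular (2 * m + 2)) := by
  let f : Fin (2 * m + 1) → Fin (2 * m + 2) := fun i =>
    if (i : ℕ) = 0 then ⟨0, by omega⟩ else ⟨i + 1, by omega⟩
  have hv : ∀ i, (f i : ℕ) = if (i : ℕ) = 0 then 0 else (i : ℕ) + 1 := by
    intro i
    simp only [f]
    split_ifs <;> rfl
  have hinj : Function.Injective f := by
    intro i j hij
    have := congrArg Fin.val hij
    rw [hv, hv] at this
    ext
    split_ifs at this <;> omega
  refine ⟨⟨⟨f, hinj⟩, ?_⟩⟩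
  intro i j
  simp only [Function.Embedding.coeFn_mk]
  rw [antiregular_adj, antiregular_adj, hinj.ne_iff, Fin.coe_max, Fin.coe_max, hv, hv, Ne,
    Fin.ext_iff]
  have := i.2
  have := j.2
  simp only [Nat.odd_iff]
  split_ifs <;> omega

end ThresholdGraph

/-! ### Threshold graphs by levels: induced anti-regular subgraphs and index bounds -/

namespace ThresholdGraph

open Finset

/-- `G` is the threshold graph in which the vertices of level `2 i` form the `i`-th block of zeros
and the vertices of level `2 i + 1` the `i`-th block of ones of the binary string (`i < k`); there
may be isolated vertices, on level `2 k`. -/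
structure IsLeveled {V : Type*} (G : SimpleGraph V) (k : ℕ) (ℓ : V → ℕ) : Prop where
  le : ∀ v, ℓ v ≤ 2 * k
  exists_eq : ∀ j < 2 * k, ∃ v, ℓ v = j
  adj_iff : ∀ v w, G.Adj v w ↔ v ≠ w ∧ Odd (max (ℓ v) (ℓ w))

namespace IsLeveled

section Induced

variable {V : Type*} {G : SimpleGraph V} {k : ℕ} {ℓ : V → ℕ}

lemma nonempty_embedding_even (h : IsLeveled G k ℓ) : Nonempty (antiregular (2 * k) ↪g G) := by
  choose f hf using fun j : Fin (2 * k) => h.exists_eq j j.2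
  have hinj : Function.Injective f := fun i j hij => Fin.ext (by rw [← hf i, ← hf j, hij])
  refine ⟨⟨⟨f, hinj⟩, ?_⟩⟩
  intro i j
  simp only [Function.Embedding.coeFn_mk]
  rw [h.adj_iff, antiregular_adj, hinj.ne_iff, hf, hf, Fin.coe_max]
  have := i.2
  have := j.2
  simp only [Nat.odd_iff]
  omega

lemma nonempty_embedding_odd (h : IsLeveled G k ℓ) (hk : 0 < k) {v w : V} (hvw : v ≠ w)
    (hv : ℓ v = 0) (hw : ℓ w = 0) : Nonempty (antiregular (2 * k + 1) ↪g G) := by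
  choose f hf using fun j : Fin (2 * k) => h.exists_eq j j.2
  let g : Fin (2 * k + 1) → V := fun j =>
    if (j : ℕ) = 0 then v else if (j : ℕ) = 1 then w else f ⟨j - 1, by omega⟩
  -- Truncated subtraction is intended: positions `0` and `1` both lie on level `0`.
  have hg : ∀ j, ℓ (g j) = (j : ℕ) - 1 := by
    intro j
    simp only [g]
    split_ifs with h1 h2
    · rw [hv, h1]
    · rw [hw, h2]
    · rw [hf]
  have hinj : Function.Injective g := by
    intro i j hij
    have h1 := hg i
    rw [hij, hg j] at h1
    ext
    by_contra hne
    rcases (by omega : ((i : ℕ) = 0 ∧ (j : ℕ) = 1) ∨ ((i : ℕ) = 1 ∧ (j : ℕ) = 0)) with h2 | h2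
    · simp only [g, h2.1, h2.2, if_true, one_ne_zero, if_false] at hij
      exact hvw hij
    · simp only [g, h2.1, h2.2, if_true, one_ne_zero, if_false] at hij
      exact hvw hij.symm
  refine ⟨⟨⟨g, hinj⟩, ?_⟩⟩
  intro i j
  simp only [Function.Embedding.coeFn_mk]
  rw [h.adj_iff, antiregular_adj, hinj.ne_iff, hg, hg, Fin.coe_max, Ne, Fin.ext_iff]
  have := i.2
  have := j.2
  simp only [Nat.odd_iff]
  omega

lemma pos_of_ne_bot (h : IsLeveled G k ℓ) (hG : G ≠ ⊥) : 0 < k := by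
  rw [Nat.pos_iff_ne_zero]
  rintro rfl
  refine hG (SimpleGraph.ext ?_)
  ext v w
  have hv := h.le v
  have hw := h.le w
  rw [h.adj_iff, show ℓ v = 0 by omega, show ℓ w = 0 by omega]
  simp

end Induced

variable {V : Type*} [Fintype V] {G : SimpleGraph V} {k : ℕ} {ℓ : V → ℕ}

/-- The sum of `u` over level `j`. -/
noncomputable def levelSum (ℓ : V → ℕ) (j : ℕ) : (V → ℝ) →ₗ[ℝ] ℝ :=
  ∑ v with ℓ v = j, LinearMap.proj v

lemma levelSum_apply (ℓ : V → ℕ) (j : ℕ) (u : V → ℝ) :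
    levelSum ℓ j u = ∑ v, if ℓ v = j then u v else 0 := by
  rw [levelSum, LinearMap.sum_apply, sum_filter]
  rfl

/-- An ordered pair is counted at the odd level that is the maximum of its two levels. The square of
a level sum also counts the diagonal of the clique on that level, which the last sum removes. -/
lemma quadForm_eq (h : IsLeveled G k ℓ) (u : V → ℝ) :
    quadForm G u = (∑ i ∈ range k, levelSum ℓ (2 * i + 1) u *
      (levelSum ℓ (2 * i + 1) u + 2 * ∑ v, if ℓ v ≤ 2 * i then u v else 0)) -
      ∑ v, if Odd (ℓ v) then u v ^ 2 else 0 := by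
  classical
  let α : ℕ → V → ℝ := fun i v => if ℓ v = 2 * i + 1 then u v else 0
  let β : ℕ → V → ℝ := fun i v => if ℓ v ≤ 2 * i then u v else 0
  have key : ∀ v w, (if G.Adj v w then u v * u w else 0) =
      (∑ i ∈ range k, (α i v * α i w + α i v * β i w + β i v * α i w)) -
        if v = w then (if Odd (ℓ v) then u v ^ 2 else 0) else 0 := by
    intro v w
    have hsum : ∑ i ∈ range k, (α i v * α i w + α i v * β i w + β i v * α i w) =
        if Odd (max (ℓ v) (ℓ w)) then u v * u w else 0 := by
      have hz : ∀ i, 2 * i + 1 ≠ max (ℓ v) (ℓ w) →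
          α i v * α i w + α i v * β i w + β i v * α i w = 0 := by
        intro i hi
        simp only [α, β]
        split_ifs <;> first | omega | simp
      split_ifs with ho
      · obtain ⟨i, hi⟩ := ho
        have hle := h.le v
        have hle' := h.le w
        rw [sum_eq_single i (fun j _ hj => hz j (by omega))
          (fun hj => absurd (mem_range.2 (by omega)) hj)]
        simp only [α, β]
        split_ifs <;> first | omega | simp
      · exact sum_eq_zero fun i _ => hz i fun hi => ho ⟨i, hi.symm⟩
    rw [hsum]
    by_cases hvw : v = w
    · subst hvw
      simp [sq]
    · simp [h.adj_iff, hvw]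
  simp only [quadForm, key, sum_sub_distrib, sum_ite_eq, mem_univ, if_true]
  congr 1
  rw [sum_congr rfl fun v _ => sum_comm, sum_comm]
  refine sum_congr rfl fun i _ => ?_
  simp only [sum_add_distrib, ← mul_sum, ← sum_mul, levelSum_apply]
  simp only [α, β]
  ring

lemma le_of_hasNegSubspace_pos (h : IsLeveled G k ℓ) {d : ℕ}
    (hd : HasNegSubspace (shiftedForm G (-1) 0) d) : d ≤ k := by
  have := hd.le_of_ker (LinearMap.pi fun i : Fin k => levelSum ℓ (2 * i + 1)) fun u hu => ?_
  · simpa using this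
  · have hu' : ∀ i ∈ range k, levelSum ℓ (2 * i + 1) u * (levelSum ℓ (2 * i + 1) u +
        2 * ∑ v, if ℓ v ≤ 2 * i then u v else 0) = 0 := by
      intro i hi
      have : levelSum ℓ (2 * i + 1) u = 0 := congrFun hu ⟨i, mem_range.1 hi⟩
      rw [this, zero_mul]
    rw [shiftedForm, h.quadForm_eq, sum_eq_zero hu']
    have : 0 ≤ ∑ v, if Odd (ℓ v) then u v ^ 2 else 0 :=
      sum_nonneg fun v _ => by split_ifs <;> positivity
    linarith

lemma sum_sq_eq (ℓ : V → ℕ) (u : V → ℝ) : ∑ v, u v ^ 2 =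
    (∑ v, if Odd (ℓ v) then u v ^ 2 else 0) + ∑ v, if Odd (ℓ v) then 0 else u v ^ 2 := by
  rw [← sum_add_distrib]
  exact sum_congr rfl fun v _ => by split_ifs <;> simp

/-- Where the `k` odd level sums vanish, adding `∑ u v ^ 2` cancels the negative squares on odd
levels, leaving only squares on even levels. -/
lemma le_of_hasNegSubspace_neg (h : IsLeveled G k ℓ) {d : ℕ}
    (hd : HasNegSubspace (shiftedForm G 1 (-1)) d) : d ≤ k := by
  have := hd.le_of_ker (LinearMap.pi fun i : Fin k => levelSum ℓ (2 * i + 1)) fun u hu => ?_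
  · simpa using this
  · have hu' : ∀ i ∈ range k, levelSum ℓ (2 * i + 1) u * (levelSum ℓ (2 * i + 1) u +
        2 * ∑ v, if ℓ v ≤ 2 * i then u v else 0) = 0 := by
      intro i hi
      have : levelSum ℓ (2 * i + 1) u = 0 := congrFun hu ⟨i, mem_range.1 hi⟩
      rw [this, zero_mul]
    rw [shiftedForm, h.quadForm_eq, sum_eq_zero hu', sum_sq_eq ℓ]
    have : 0 ≤ ∑ v, if Odd (ℓ v) then 0 else u v ^ 2 :=
      sum_nonneg fun v _ => by split_ifs <;> positivity
    linarith

/-- With `σ` the sum over level `1`, the first block contributes `σ (σ + 2 u v₀)`, and the square `u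
v₀ ^ 2` completes this to `(σ + u v₀)² ≥ 0`. No condition on level `1` is therefore needed. -/
lemma lt_of_hasNegSubspace_neg (h : IsLeveled G (k + 1) ℓ) {v₀ : V} (hv₀ : ∀ v, ℓ v = 0 ↔ v = v₀)
    {d : ℕ} (hd : HasNegSubspace (shiftedForm G 1 (-1)) d) : d ≤ k := by
  classical
  have := hd.le_of_ker (LinearMap.pi fun i : Fin k => levelSum ℓ (2 * (i + 1) + 1))
    fun u hu => ?_
  · simpa using this
  · have hu' : ∀ i ∈ range k, levelSum ℓ (2 * (i + 1) + 1) u * (levelSum ℓ (2 * (i + 1) + 1) u +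
        2 * ∑ v, if ℓ v ≤ 2 * (i + 1) then u v else 0) = 0 := by
      intro i hi
      have : levelSum ℓ (2 * (i + 1) + 1) u = 0 := congrFun hu ⟨i, mem_range.1 hi⟩
      rw [this, zero_mul]
    rw [shiftedForm, h.quadForm_eq, sum_range_succ', sum_eq_zero hu', sum_sq_eq ℓ]
    have h1 : u v₀ ^ 2 ≤ ∑ v, if Odd (ℓ v) then 0 else u v ^ 2 := by
      have := single_le_sum (f := fun v => if Odd (ℓ v) then 0 else u v ^ 2)
        (fun v _ => by split_ifs <;> positivity) (mem_univ v₀)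
      simpa [(hv₀ v₀).2 rfl] using this
    simp only [mul_zero, nonpos_iff_eq_zero, hv₀, sum_ite_eq', mem_univ, if_true]
    nlinarith [sq_nonneg (levelSum ℓ (0 + 1) u + u v₀)]

end IsLeveled

/-! ### Threshold graphs -/

/-- Either a heaviest vertex is adjacent to all others, or a lightest one is isolated: a
non-neighbour of the heaviest vertex weighs at least as much as the lightest. That vertex is removed
and put back on top of the levels of the rest. -/
lemma exists_isLeveled_on {V : Type*} (G : SimpleGraph V) (w : V → ℝ) (t : ℝ)
    (hw : ∀ u v, G.Adj u v ↔ u ≠ v ∧ t < w u + w v) (s : Finset V) :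
    ∃ (k : ℕ) (ℓ : V → ℕ), (∀ v ∈ s, ℓ v ≤ 2 * k) ∧ (∀ j < 2 * k, ∃ v ∈ s, ℓ v = j) ∧
      ∀ v ∈ s, ∀ v' ∈ s, G.Adj v v' ↔ v ≠ v' ∧ Odd (max (ℓ v) (ℓ v')) := by
  classical
  induction s using Finset.strongInduction with
  | H s ih =>
    rcases s.eq_empty_or_nonempty with rfl | hs
    · exact ⟨0, 0, by simp⟩
    -- adding a vertex `a` on level `m`, above all other vertices
    have step : ∀ a ∈ s, ∀ (m : ℕ) (ℓ : V → ℕ), (∀ v ∈ s.erase a, ℓ v ≤ m) →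
        (∀ v ∈ s.erase a, ∀ v' ∈ s.erase a, G.Adj v v' ↔ v ≠ v' ∧ Odd (max (ℓ v) (ℓ v'))) →
        (∀ v ∈ s.erase a, G.Adj a v ↔ Odd m) →
        ∀ v ∈ s, ∀ v' ∈ s, G.Adj v v' ↔ v ≠ v' ∧
          Odd (max (Function.update ℓ a m v) (Function.update ℓ a m v')) := by
      intro a ha m ℓ hle hadj ham v hv v' hv'
      by_cases h : v = a
      · subst h
        by_cases h' : v' = v
        · subst h'
          simp
        · have := mem_erase.2 ⟨h', hv'⟩
          rw [Function.update_self, Function.update_of_ne h', max_eq_left (hle v' this), ham v' this]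
          exact ⟨fun h => ⟨Ne.symm h', h⟩, fun h => h.2⟩
      · have hm := mem_erase.2 ⟨h, hv⟩
        by_cases h' : v' = a
        · subst h'
          rw [Function.update_self, Function.update_of_ne h, max_eq_right (hle v hm), G.adj_comm,
            ham v hm]
          exact ⟨fun h1 => ⟨h, h1⟩, fun h => h.2⟩
        · rw [Function.update_of_ne h, Function.update_of_ne h']
          exact hadj v hm v' (mem_erase.2 ⟨h', hv'⟩)
    have upd : ∀ (a : V) (m j : ℕ) (ℓ : V → ℕ), (∃ v ∈ s.erase a, ℓ v = j) →
        ∃ v ∈ s, Function.update ℓ a m v = j := by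
      rintro a m j ℓ ⟨v, hv, rfl⟩
      exact ⟨v, mem_of_mem_erase hv, Function.update_of_ne (ne_of_mem_erase hv) _ _⟩
    have hle' : ∀ (a : V) (m M : ℕ) (ℓ : V → ℕ), m ≤ M → (∀ v ∈ s.erase a, ℓ v ≤ M) →
        ∀ v ∈ s, Function.update ℓ a m v ≤ M := by
      intro a m M ℓ hm h v hv
      by_cases hva : v = a
      · subst hva
        rwa [Function.update_self]
      · rw [Function.update_of_ne hva]
        exact h v (mem_erase.2 ⟨hva, hv⟩)
    obtain ⟨a, ha, hmax⟩ := exists_max_image s w hs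
    obtain ⟨b, hb, hmin⟩ := exists_min_image s w hs
    by_cases hdom : ∀ v ∈ s.erase a, G.Adj a v
    · obtain ⟨k, ℓ, h1, h2, h3⟩ := ih (s.erase a) (erase_ssubset ha)
      -- A dominating vertex opens the new level `2 k + 1` only if level `2 k` is occupied.
      -- Otherwise it joins the last block of ones, on level `2 k - 1`; for `k = 0` no other vertex
      -- is left.
      by_cases htop : ∃ v ∈ s.erase a, ℓ v = 2 * k
      · refine ⟨k + 1, Function.update ℓ a (2 * k + 1), hle' _ _ _ _ (by omega) fun v hv =>
          (h1 v hv).trans (by omega), fun j hj => ?_, step a ha _ ℓ (fun v hv =>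
          (h1 v hv).trans (by omega)) h3 fun v hv => ⟨fun _ => ⟨k, rfl⟩, fun _ => hdom v hv⟩⟩
        rcases (by omega : j < 2 * k ∨ j = 2 * k ∨ j = 2 * k + 1) with hj | rfl | rfl
        · exact upd _ _ _ _ (h2 j hj)
        · exact upd _ _ _ _ htop
        · exact ⟨a, ha, Function.update_self _ _ _⟩
      · rcases Nat.eq_zero_or_pos k with rfl | hk
        · refine ⟨0, Function.update ℓ a 0, hle' _ _ _ _ le_rfl h1, by simp,
            step a ha 0 ℓ h1 h3 fun v hv => ?_⟩
          exact absurd ⟨v, hv, Nat.le_zero.1 (h1 v hv)⟩ htop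
        · have h1' : ∀ v ∈ s.erase a, ℓ v ≤ 2 * k - 1 := by
            intro v hv
            have := h1 v hv
            have : ℓ v ≠ 2 * k := fun h => htop ⟨v, hv, h⟩
            omega
          exact ⟨k, Function.update ℓ a (2 * k - 1), hle' _ _ _ _ (by omega) h1,
            fun j hj => upd _ _ _ _ (h2 j hj), step a ha _ ℓ h1' h3 fun v hv =>
            ⟨fun _ => ⟨k - 1, by omega⟩, fun _ => hdom v hv⟩⟩
    · have hiso : ∀ v ∈ s.erase b, ¬ G.Adj b v := by
        intro v hv hadj
        push Not at hdom
        obtain ⟨c, hc, hac⟩ := hdom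
        rw [hw] at hac hadj
        have h1 : w a + w c ≤ t := not_lt.1 fun h => hac ⟨(ne_of_mem_erase hc).symm, h⟩
        have h2 := hmin c (mem_of_mem_erase hc)
        have h3 := hmax v (mem_of_mem_erase hv)
        linarith [hadj.2]
      obtain ⟨k, ℓ, h1, h2, h3⟩ := ih (s.erase b) (erase_ssubset hb)
      exact ⟨k, Function.update ℓ b (2 * k), hle' _ _ _ _ le_rfl h1,
        fun j hj => upd _ _ _ _ (h2 j hj), step b hb _ ℓ h1 h3 fun v hv =>
        ⟨fun h => absurd h (hiso v hv), fun h => absurd h (Nat.not_odd_iff_even.2 (even_two_mul k))⟩⟩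

lemma IsThreshold.exists_isLeveled {V : Type*} [Fintype V] {G : SimpleGraph V}
    (h : IsThreshold G) : ∃ k ℓ, IsLeveled G k ℓ := by
  classical
  obtain ⟨w, t, -, -, h⟩ := h
  have hw : ∀ u v, G.Adj u v ↔ u ≠ v ∧ t < w u + w v := by
    intro u v
    by_cases huv : u = v
    · subst huv
      simp
    · have := h {u, v}
      rw [sum_pair huv] at this
      rw [← not_le, ← this, coe_pair, SimpleGraph.isIndepSet_iff, Set.pairwise_pair]
      simp [huv, G.adj_comm v u]
  obtain ⟨k, ℓ, h1, h2, h3⟩ := exists_isLeveled_on G w t hw univ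
  exact ⟨k, ℓ, fun v => h1 v (mem_univ v), fun j hj => (h2 j hj).imp fun v hv => hv.2,
    fun v v' => h3 v (mem_univ v) v' (mem_univ v')⟩

/-! ### Binary strings -/

/-- The levels of the vertices of the graph with string `0^{s_1} 1^{t_1} ⋯ 0^{s_k} 1^{t_k}`. -/
def levelList {k : ℕ} (s t : Fin k → ℕ) : List ℕ :=
  (List.ofFn fun i : Fin k => List.replicate (s i) (2 * (i : ℕ)) ++
    List.replicate (t i) (2 * (i : ℕ) + 1)).flatten

lemma map_levelList {k : ℕ} (s t : Fin k → ℕ) :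
    (levelList s t).map (fun j => decide (Odd j)) = blockString s t := by
  rw [levelList, blockString, List.map_flatten, List.map_ofFn]
  congr 2
  funext i
  simp

lemma pairwise_levelList {k : ℕ} (s t : Fin k → ℕ) : (levelList s t).Pairwise (· ≤ ·) := by
  rw [levelList, List.pairwise_flatten]
  constructor
  · intro l hl
    obtain ⟨i, rfl⟩ := (List.mem_ofFn' _ _).1 hl
    rw [List.pairwise_append]
    refine ⟨by simp [List.pairwise_replicate], by simp [List.pairwise_replicate], ?_⟩
    intro a ha b hb
    rw [List.eq_of_mem_replicate ha, List.eq_of_mem_replicate hb]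
    omega
  · rw [List.pairwise_ofFn]
    intro i j hij a ha b hb
    have : (i : ℕ) < j := hij
    simp only [List.mem_append, List.mem_replicate] at ha hb
    omega

lemma mem_levelList {k : ℕ} {s t : Fin k → ℕ} {a : ℕ} : a ∈ levelList s t ↔
    ∃ i, (s i ≠ 0 ∧ a = 2 * (i : ℕ)) ∨ (t i ≠ 0 ∧ a = 2 * (i : ℕ) + 1) := by
  simp [levelList, List.mem_flatten, List.mem_ofFn, List.mem_replicate]

lemma count_zero_levelList {k : ℕ} (s t : Fin (k + 1) → ℕ) : (levelList s t).count 0 = s 0 := by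
  rw [levelList, List.ofFn_succ, List.flatten_cons, List.count_append, List.count_append]
  have : List.count 0 (List.ofFn fun i : Fin k => List.replicate (s i.succ) (2 * (i.succ : ℕ)) ++
      List.replicate (t i.succ) (2 * (i.succ : ℕ) + 1)).flatten = 0 := by
    rw [List.count_eq_zero]
    simp [List.mem_flatten, List.mem_ofFn, List.mem_replicate]
  rw [this]
  simp [List.count_replicate]

/-- The level of a position has the parity of its digit. Levels are monotone along the string, so
the level of the later vertex is the maximum of the two levels. -/
lemma HasBlockString.exists_isLeveled {V : Type*} [Fintype V] {G : SimpleGraph V} {k : ℕ}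
    {s t : Fin k → ℕ} (h : HasBlockString G s t) (hk : 0 < k) :
    ∃ ℓ, IsLeveled G k ℓ ∧ (univ.filter fun v => ℓ v = 0).card = s ⟨0, hk⟩ := by
  obtain ⟨hs, ht, n, b, hb, ⟨e⟩⟩ := h
  have hlen : (levelList s t).length = n := by
    have := congrArg List.length hb
    rw [← map_levelList] at this
    simpa using this.symm
  subst hlen
  have hbl : ∀ i, b i = decide (Odd ((levelList s t).get i)) := by
    intro i
    have h1 : (List.ofFn b)[(i : ℕ)]? = some (b i) := by simp
    rw [hb, ← map_levelList] at h1
    simpa using h1.symm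
  have hmono : Monotone (levelList s t).get := by
    intro i j hij
    rcases hij.eq_or_lt with rfl | hij
    · exact le_rfl
    · exact List.pairwise_iff_get.1 (pairwise_levelList s t) i j hij
  refine ⟨fun v => (levelList s t).get (e v), ⟨fun v => ?_, fun j hj => ?_, fun v w => ?_⟩, ?_⟩
  · obtain ⟨i, hi⟩ := mem_levelList.1 ((levelList s t).get_mem (e v))
    have := i.2
    omega
  · have : j ∈ levelList s t := by
      rw [mem_levelList]
      refine ⟨⟨j / 2, by omega⟩, ?_⟩
      have := hs ⟨j / 2, by omega⟩
      have := ht ⟨j / 2, by omega⟩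
      dsimp only
      omega
    obtain ⟨i, hi⟩ := List.mem_iff_get.1 this
    exact ⟨e.symm i, by simpa using hi⟩
  · have h1 : (ofString b).Adj (e v) (e w) ↔ e v ≠ e w ∧ b (max (e v) (e w)) = true := Iff.rfl
    rw [← e.map_adj_iff, h1, hbl, decide_eq_true_eq, hmono.map_max, e.injective.ne_iff]
  · obtain ⟨k, rfl⟩ := Nat.exists_eq_succ_of_ne_zero hk.ne'
    have h1 := count_zero_levelList s t
    rw [show (⟨0, hk⟩ : Fin (k + 1)) = 0 from rfl, ← h1]
    have h2 : (univ.filter fun v => (levelList s t).get (e v) = 0).card =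
        (univ.filter fun i => (levelList s t).get i = 0).card := by
      refine card_bij (fun v _ => e v) (fun v hv => by simpa using hv)
        (fun v _ w _ h => e.injective h) fun i hi => ⟨e.symm i, by simpa using hi, by simp⟩
    rw [h2]
    exact Fin.card_filter_univ_eq_vector_get_eq_count 0 ⟨levelList s t, rfl⟩

end ThresholdGraph

/-! ### Comparison of `A_n` with threshold graphs -/

namespace ThresholdGraph

lemma antiregular_hasNegSubspace_of_add_two_mul {n d : ℕ} {ε x : ℝ} (hx : ε * x ≤ 0) (j : ℕ)
    (h : HasNegSubspace (shiftedForm (antiregular (n + 2 * j)) ε x) (d + j)) :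
    HasNegSubspace (shiftedForm (antiregular n) ε x) d := by
  induction j with
  | zero => exact h
  | succ j ih => exact ih (antiregular_hasNegSubspace_of_add_two hx h)

lemma antiregular_even_hasNegSubspace_neg {m : ℕ} (hm : 1 ≤ m) :
    HasNegSubspace (shiftedForm (antiregular (2 * m)) 1 (-1)) (m - 1) := by
  obtain ⟨m, rfl⟩ := Nat.exists_eq_add_of_le' hm
  obtain ⟨f⟩ := nonempty_antiregular_embedding m
  exact hasNegSubspace_of_embedding f (antiregular_hasNegSubspace_neg m)

/-- If `a = μ⁻(A_{2m})` is smaller than `y`, then `A_{2m}` has `m - 1` eigenvalues below `y`. -/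
lemma hasNegSubspace_of_isMuMinus {m : ℕ} (hm : 1 ≤ m) {a y : ℝ}
    (ha : IsMuMinus (antiregular (2 * m)) a) (hy : a < y) :
    HasNegSubspace (shiftedForm (antiregular (2 * m)) 1 y) (m - 1) := by
  refine hasNegSubspace_of_forall (fun z hz hz' => ?_) (antiregular_even_hasNegSubspace_neg hm)
  have := ha.2 ⟨hz, by linarith⟩
  linarith

lemma hasNegSubspace_of_isMuPlus {m : ℕ} {a y : ℝ}
    (ha : IsMuPlus (antiregular (2 * m)) a) (hy : y < a) :
    HasNegSubspace (shiftedForm (antiregular (2 * m)) (-1) y) m := by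
  refine hasNegSubspace_of_forall (fun z hz hz' => ?_) (antiregular_hasNegSubspace_pos m)
  have := ha.2 ⟨hz, by linarith⟩
  linarith

namespace IsLeveled

variable {V : Type*} [Fintype V] {G : SimpleGraph V} {k m : ℕ} {ℓ : V → ℕ}

lemma two_mul_le_card (h : IsLeveled G k ℓ) : 2 * k ≤ Fintype.card V := by
  obtain ⟨f⟩ := h.nonempty_embedding_even
  simpa using Fintype.card_le_of_embedding f.toEmbedding

theorem exists_isMuPlus_le (h : IsLeveled G k ℓ) (hk : 0 < k) (hV : Fintype.card V = 2 * m) :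
    ∃ a g, IsMuPlus (antiregular (2 * m)) a ∧ IsMuPlus G g ∧ a ≤ g := by
  have hkm : k ≤ m := by have := h.two_mul_le_card; omega
  obtain ⟨f⟩ := h.nonempty_embedding_even
  obtain ⟨a, ha⟩ := exists_isMuPlus ((antiregular_hasNegSubspace_pos m).anti (by omega : 1 ≤ m))
  obtain ⟨g, hg⟩ := exists_isMuPlus
    ((hasNegSubspace_of_embedding f (antiregular_hasNegSubspace_pos k)).anti (by omega : 1 ≤ k))
  refine ⟨a, g, ha, hg, ?_⟩
  by_contra! hlt
  obtain ⟨y, hgy, hya⟩ := exists_between hlt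
  have hy : 0 < y := hg.1.2.trans hgy
  have h1 : HasNegSubspace (shiftedForm (antiregular (2 * m)) (-1) y) (k + (m - k)) := by
    rw [Nat.add_sub_cancel' hkm]
    exact hasNegSubspace_of_isMuPlus ha hya
  rw [show 2 * m = 2 * k + 2 * (m - k) by omega] at h1
  have h2 := antiregular_hasNegSubspace_of_add_two_mul (by linarith) _ h1
  -- `G` has `k` eigenvalues above `y`, and `g`, which lies in `(0, y)`, is one more positive
  -- eigenvalue.
  have h3 := hasNegSubspace_succ (x := 0) hg.1.1 (by linarith [hg.1.2]) (by linarith)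
    (hasNegSubspace_of_embedding f h2)
  have := h.le_of_hasNegSubspace_pos h3
  omega

lemma exists_isMuMinus (h : IsLeveled G k ℓ) (hk : 2 ≤ k) : ∃ g, IsMuMinus G g := by
  obtain ⟨f⟩ := h.nonempty_embedding_even
  exact ThresholdGraph.exists_isMuMinus ((hasNegSubspace_of_embedding f
    (antiregular_even_hasNegSubspace_neg (by omega))).anti (by omega))

theorem exists_isMuMinus_ge (h : IsLeveled G k ℓ) (hk : 0 < k) {v₀ : V}
    (hv₀ : ∀ v, ℓ v = 0 ↔ v = v₀) (hV : Fintype.card V = 2 * m) {g : ℝ} (hg : IsMuMinus G g) :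
    ∃ a, IsMuMinus (antiregular (2 * m)) a ∧ g ≤ a := by
  have hkm : k ≤ m := by have := h.two_mul_le_card; omega
  obtain ⟨f⟩ := h.nonempty_embedding_even
  obtain ⟨k, rfl⟩ := Nat.exists_eq_succ_of_ne_zero hk.ne'
  -- An eigenvalue of `G` below `-1` forces at least two blocks; hence `m ≥ 2`, and `A_{2m}` has an
  -- eigenvalue below `-1` too.
  have hk1 : 1 ≤ k := h.lt_of_hasNegSubspace_neg hv₀
    (hasNegSubspace_one hg.1.1 (by linarith [hg.1.2]))
  obtain ⟨a, ha⟩ := ThresholdGraph.exists_isMuMinus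
    ((antiregular_even_hasNegSubspace_neg (m := m) (by omega)).anti (by omega))
  refine ⟨a, ha, ?_⟩
  by_contra! hlt
  obtain ⟨y, hay, hyg⟩ := exists_between hlt
  have hy : y < -1 := hyg.trans hg.1.2
  have h1 := hasNegSubspace_of_isMuMinus (by omega) ha hay
  rw [show m - 1 = k + (m - (k + 1)) by omega,
    show 2 * m = 2 * (k + 1) + 2 * (m - (k + 1)) by omega] at h1
  have h2 := antiregular_hasNegSubspace_of_add_two_mul (by linarith) _ h1
  have h3 := hasNegSubspace_succ (x := -1) hg.1.1 (by linarith [hg.1.2]) (by linarith)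
    (hasNegSubspace_of_embedding f h2)
  have := h.lt_of_hasNegSubspace_neg hv₀ h3
  omega

theorem exists_isMuMinus_le (h : IsLeveled G k ℓ) (hk : 0 < k) {v w : V} (hvw : v ≠ w)
    (hv : ℓ v = 0) (hw : ℓ w = 0) (hkm : k + 2 ≤ m) :
    ∃ a g, IsMuMinus (antiregular (2 * m)) a ∧ IsMuMinus G g ∧ g ≤ a := by
  obtain ⟨f⟩ := h.nonempty_embedding_odd hk hvw hv hw
  obtain ⟨a, ha⟩ := ThresholdGraph.exists_isMuMinus
    ((antiregular_even_hasNegSubspace_neg (m := m) (by omega)).anti (by omega))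
  obtain ⟨g, hg⟩ := ThresholdGraph.exists_isMuMinus
    ((hasNegSubspace_of_embedding f (antiregular_hasNegSubspace_neg k)).anti (by omega : 1 ≤ k))
  refine ⟨a, g, ha, hg, ?_⟩
  by_contra! hlt
  obtain ⟨y, hay, hyg⟩ := exists_between hlt
  have hy : y < -1 := hyg.trans hg.1.2
  have h1 := hasNegSubspace_of_isMuMinus (by omega) ha hay
  -- Descending by twos from `A_{2m}` to `A_{2k+4}` leaves `k + 1` eigenvalues below `y`; the step
  -- to `A_{2k+1}` leaves `k`.
  rw [show m - 1 = k + 1 + (m - (k + 2)) by omega,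
    show 2 * m = 2 * k + 4 + 2 * (m - (k + 2)) by omega] at h1
  have h2 := antiregular_hasNegSubspace_of_add_three hy
    (antiregular_hasNegSubspace_of_add_two_mul (by linarith) _ h1)
  have h3 := hasNegSubspace_succ (x := -1) hg.1.1 (by linarith [hg.1.2]) (by linarith)
    (hasNegSubspace_of_embedding f h2)
  have := h.le_of_hasNegSubspace_neg h3
  omega

end IsLeveled

end ThresholdGraph

open ThresholdGraph in
theorem theorem4p5 (n : ℕ) (hn : 2 ≤ n) (heven : Even n)
    {V : Type*} [Fintype V] (hV : Fintype.card V = n) (G : SimpleGraph V) :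
    -- the optimality of `μ⁺` among all threshold graphs (`μ⁺(G)` exists when `G` has an edge)
    (IsThreshold G → G ≠ ⊥ →
      ∃ a g : ℝ, IsMuPlus (antiregular n) a ∧ IsMuPlus G g ∧ a ≤ g) ∧
    -- the statements on `μ⁻` for binary strings `0^{s_1} 1^{t_1} ⋯ 0^{s_k} 1^{t_k}`
    (∀ (k : ℕ) (hk : 0 < k) (s t : Fin k → ℕ), HasBlockString G s t →
      -- `s_1 = 1`: here `μ⁻(G)` exists when `k ≥ 2`
      (s ⟨0, hk⟩ = 1 →
        (2 ≤ k → ∃ g : ℝ, IsMuMinus G g) ∧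
        ∀ g : ℝ, IsMuMinus G g → ∃ a : ℝ, IsMuMinus (antiregular n) a ∧ g ≤ a) ∧
      -- `s_1 ≥ 2` and `2k + 2 < n`
      (2 ≤ s ⟨0, hk⟩ → 2 * k + 2 < n →
        ∃ a g : ℝ, IsMuMinus (antiregular n) a ∧ IsMuMinus G g ∧ g ≤ a)) := by
  obtain ⟨m, rfl⟩ := even_iff_exists_two_mul.1 heven
  refine ⟨fun hG hne => ?_, fun k hk s t hst => ?_⟩
  · obtain ⟨k, ℓ, h⟩ := hG.exists_isLeveled
    exact h.exists_isMuPlus_le (h.pos_of_ne_bot hne) hV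
  · obtain ⟨ℓ, h, hcard⟩ := hst.exists_isLeveled hk
    refine ⟨fun hs => ⟨h.exists_isMuMinus, fun g hg => ?_⟩, fun hs hkm => ?_⟩
    · rw [hs, Finset.card_eq_one] at hcard
      obtain ⟨v₀, hv₀⟩ := hcard
      refine h.exists_isMuMinus_ge (v₀ := v₀) hk (fun v => ?_) hV hg
      simpa using Finset.ext_iff.1 hv₀ v
    · rw [← hcard] at hs
      obtain ⟨v, hv, w, hw, hvw⟩ := Finset.one_lt_card.1 hs
      exact h.exists_isMuMinus_le hk hvw (Finset.mem_filter.1 hv).2 (Finset.mem_filter.1 hw).2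
        (by omega)
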